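/- **Setting.** Let $\mathcal P$ be a set of $N$ players and $\mathcal A$ a set of $K$ arms, $N\le K$. Every arm $a$ has a known strict preference list $\pi_a$ over $\mathcal P$. A player $p$ matched with an arm $a$ receives a random reward in $[0,1]$ with unknown law $\mathbb P_{p,a}$ and mean $\mu_{p,a}$; rewards obtained in different sampled matchings are independent. For each $p$ the means $\mu_{p,a}$, $a\in\mathcal A$, are pairwise different, and $p$ prefers $a$ to $a'$ iff $\mu_{p,a}>\mu_{p,a'}$. A matching is a set of pairwise disjoint player-arm pairs; it is stable if there is no pair $(p,a)$, not matched with each other, such that $p$ is unmatched or prefers $a$ to its partner and $a$ is unmatched or prefers $p$ to its partner. The player-optimal stable matching $m_s^\star$ is the stable matching in which each player is matched with its most preferred partner among all stable matchings. An algorithm samples one matching at a time, observes the rewards of the matched players, and may at some time terminate and return a matching. It is $\delta$-PCOS if, for every such market, there is a finite $T$ (which may depend on the market and on $\delta$) such that with probability at least $1-\delta$ it outputs $m_s^\star$ after at most $T$ sampled matchings. **Adaptive Sampling Algorithm.** Input: $\delta>0$, $\mathcal P$, $\mathcal A$, $(\pi_a)_{a\in\mathcal A}$. Start with $S_p=\mathcal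 A$ for all $p$. While some $S_p$ is non-empty, do a round: 1. Sample the matchings of a minimal matching cover of $\{(p,a): a\in S_p\}$, i.e. a smallest possible collection of matchings covering these pairs, which contains each of these pairs exactly once and no other pair. 2. For all $p,a$ let $t_{p,a}$ be the number of samples of $(p,a)$ so far, $\hat\mu_{p,a}$ their mean, $\alpha_{p,a}=\sqrt{\ln(4KN t_{p,a}^2/\delta)/(2t_{p,a})}$ and $C_{p,a}=[\hat\mu_{p,a}-\alpha_{p,a},\hat\mu_{p,a}+\alpha_{p,a}]$. 3. Let $\hat\pi_p$ list the arms by decreasing $\hat\mu_{p,a}$ (ties broken by any fixed rule), let $m$ be the output of the player-proposing Deferred Acceptance algorithm for $(\hat\pi_p)_p$ and $(\pi_a)_a$, and let $A[p]$ be the set of arms that $\hat\pi_p$ ranks at least as high as $m(p)$. 4. For each $p$ let $S_p$ be the set of all $a\in\mathcal A$ for which there is $a'\in\mathcal A\setminus\{a\}$ with $C_{p,a'}\cap C_{p,a}\ne\emptyset$ and $\{a,a'\}\cap A[p]\neq\emptyset$. When all $S_p$ are empty, return the last $m$. **Theorem.** For every $\delta>0$, the Adaptive Sampling Algorithm is $\delta$-PCOS.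 -/

import Mathlib

open MeasureTheory ProbabilityTheory

universe u v w

namespace StableBandit

/-! ### Two-sided markets, matchings and stability

A matching between the players `P` and the arms `A` is a `PEquiv P A` (written `P ≃. A`): it is given
by mutually inverse partial maps, and `a ∈ m p` means that `p` and `a` are matched under `m`. -/

/-- A strict preference list over `α`: `r i` is the agent in position `i`, position `0` being the
most preferred one. -/
abbrev Ranking (α : Type u) [Fintype α] : Type u := Fin (Fintype.card α) ≃ α

/-- `r.Prefers a b`: `a` is strictly preferred to `b`. -/
def Ranking.Prefers {α : Type u} [Fintype α] (r : Ranking α) (a b : α) : Prop :=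
  r.symm a < r.symm b

section Matching

variable {P : Type u} {A : Type v} [Fintype P] [Fintype A]

/-- `(p, a)` is a blocking pair of the matching `m`: they are not matched with each other, `p` is
unmatched or prefers `a` to its partner, and `a` is unmatched or prefers `p` to its partner. -/
def IsBlockingPair (π : P → Ranking A) (ρ : A → Ranking P) (m : P ≃. A) (p : P) (a : A) : Prop :=
  a ∉ m p ∧ (∀ b ∈ m p, (π p).Prefers a b) ∧ (∀ q ∈ m.symm a, (ρ a).Prefers p q)

/-- The matching `m` is stable. -/
def IsStable (π : P → Ranking A) (ρ : A → Ranking P) (m : P ≃. A) : Prop :=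
  ∀ p a, ¬ IsBlockingPair π ρ m p a

/-- `m` is the player-optimal stable matching: it is stable, and a player who is matched in some
stable matching is matched under `m` with an arm that it likes at least as much. -/
def IsOptimalStable (π : P → Ranking A) (ρ : A → Ranking P) (m : P ≃. A) : Prop :=
  IsStable π ρ m ∧
    ∀ m' : P ≃. A, IsStable π ρ m' → ∀ p, ∀ a' ∈ m' p, ∃ a ∈ m p, a = a' ∨ (π p).Prefers a a'

end Matching

/-! ### The deferred acceptance algorithm, players proposing -/

section DeferredAcceptance

variable {P : Type u} {A : Type v} [Fintype P] [Fintype A] [DecidableEq A]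

/-- The next proposal of `p`: the first arm on its list that has not rejected it
(`R p` is the set of arms that have rejected `p`). -/
def proposal (π : P → Ranking A) (R : P → Finset A) (p : P) : Option A :=
  ((List.finRange (Fintype.card A)).map (π p)).find? (fun a => decide (a ∉ R p))

/-- The proposer that arm `a` holds: the first player on its list among those proposing to it. -/
def held (π : P → Ranking A) (ρ : A → Ranking P) (R : P → Finset A) (a : A) : Option P :=
  ((List.finRange (Fintype.card P)).map (ρ a)).find? (fun p => decide (proposal π R p = some a))

/-- One stage: every arm keeps the proposer it holds and rejects all its other proposers. -/
def daStage [DecidableEq P] (π : P → Ranking A) (ρ : A → Ranking P) (R : P → Finset A) (p : P) : Finset A :=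
  R p ∪ Finset.univ.filter (fun a => proposal π R p = some a ∧ held π ρ R a ≠ some p)

/-- The rejections at the end. A stage without a new rejection changes nothing any more, so
`card P * card A` stages suffice. -/
def finalRejections [DecidableEq P] (π : P → Ranking A) (ρ : A → Ranking P) : P → Finset A :=
  (daStage π ρ)^[Fintype.card P * Fintype.card A] (fun _ => ∅)

theorem proposal_of_held (π : P → Ranking A) (ρ : A → Ranking P) (R : P → Finset A) (p : P) (a : A)
    (h : held π ρ R a = some p) : proposal π R p = some a := by
  simpa using List.find?_some h

/-- The matching returned by deferred acceptance: players are matched with the arms holding them. -/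
def deferredAcceptance [DecidableEq P] (π : P → Ranking A) (ρ : A → Ranking P) : P ≃. A where
  toFun p := (proposal π (finalRejections π ρ) p).filter
    (fun a => decide (held π ρ (finalRejections π ρ) a = some p))
  invFun a := held π ρ (finalRejections π ρ) a
  inv p a := by
    have h := proposal_of_held π ρ (finalRejections π ρ) p a
    simp only [Option.filter_eq_some_iff, decide_eq_true_eq]
    exact ⟨fun h' => ⟨h h', h'⟩, fun h' => h'.2⟩

end DeferredAcceptance

/-! ### Learning protocol -/

/-- A market: the (known) preferences of the arms, the (unknown) preferences of the players, and the
(unknown) laws on `[0, 1]` of the rewards. A player prefers the arms with larger mean reward, and the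
mean rewards of different arms differ. -/
structure Market (P : Type u) (A : Type v) [Fintype P] [Fintype A] where
  armPref : A → Ranking P
  playerPref : P → Ranking A
  rewardLaw : P → A → Measure ℝ
  isProbabilityMeasure : ∀ p a, IsProbabilityMeasure (rewardLaw p a)
  mem_unitInterval : ∀ p a, ∀ᵐ x ∂(rewardLaw p a), x ∈ Set.Icc (0 : ℝ) 1
  strictAnti_mean : ∀ p, StrictAnti fun i => ∫ x, x ∂(rewardLaw p (playerPref p i))

/-- `X t ω p a` is the reward that player `p` receives if it is matched with arm `a` in the matching
sampled at time `t`. Rewards at different times are independent, with the laws of the market. (Nothing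
is assumed on the joint law of the rewards at one time.) -/
structure IsRewardSequence {P : Type u} {A : Type v} [Fintype P] [Fintype A] (M : Market P A)
    {Ω : Type w} [MeasurableSpace Ω] (μ : Measure Ω) (X : ℕ → Ω → P → A → ℝ) : Prop where
  measurable : ∀ t, Measurable (X t)
  indep : iIndepFun X μ
  law : ∀ t p a, μ.map (fun ω => X t ω p a) = M.rewardLaw p a

/-- What an algorithm does next: sample a matching, or terminate and return a matching. -/
inductive Action (P : Type u) (A : Type v) : Type (max u v)
  | sample (m : P ≃. A)
  | output (m : P ≃. A)

/-- A (deterministic) sampling algorithm. After sampling a matching it sees the reward of every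
matched player (`none` for the unmatched ones) and updates its state. -/
structure SamplingAlgorithm (P : Type u) (A : Type v) where
  State : Type (max u v)
  start : State
  action : State → Action P A
  observe : State → (P → Option ℝ) → State

namespace SamplingAlgorithm

variable {P : Type u} {A : Type v} (alg : SamplingAlgorithm P A)

/-- One time step with potential rewards `x`. A terminated algorithm does not move. -/
def step (x : P → A → ℝ) (σ : alg.State) : alg.State :=
  match alg.action σ with
  | .sample m => alg.observe σ (fun p => (m p).map (x p))
  | .output _ => σ

/-- The state after `t` time steps, i.e. after `t` sampled matchings or at termination. -/
def run (x : ℕ → P → A → ℝ) : ℕ → alg.State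
  | 0 => alg.start
  | t + 1 => alg.step (x t) (run x t)

/-- The algorithm returns `m` after at most `T` sampled matchings. -/
def Returns (x : ℕ → P → A → ℝ) (T : ℕ) (m : P ≃. A) : Prop :=
  alg.action (alg.run x T) = .output m

end SamplingAlgorithm

/-- On the market `M`, with probability at least `1 - δ`, the algorithm outputs the player-optimal
stable matching after at most `T` sampled matchings. -/
def IsPCOSWith {P : Type u} {A : Type v} [Fintype P] [Fintype A] (alg : SamplingAlgorithm P A)
    (M : Market P A) (δ : ℝ) (T : ℕ) : Prop :=
  ∀ (Ω : Type w) [MeasurableSpace Ω] (μ : Measure Ω) [IsProbabilityMeasure μ]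
    (X : ℕ → Ω → P → A → ℝ), IsRewardSequence M μ X →
    ENNReal.ofReal (1 - δ) ≤ μ {ω | ∃ m : P ≃. A,
      alg.Returns (fun t => X t ω) T m ∧ IsOptimalStable M.playerPref M.armPref m}

/-- An algorithm, which is given the preferences of the arms, is `δ`-PCOS: on every market it outputs
the player-optimal stable matching with probability at least `1 - δ`, after a number of sampled
matchings that is bounded by a constant depending on the market. -/
def IsPCOS {P : Type u} {A : Type v} [Fintype P] [Fintype A]
    (alg : (A → Ranking P) → SamplingAlgorithm P A) (δ : ℝ) : Prop :=
  ∀ M : Market P A, ∃ T : ℕ, IsPCOSWith.{u, v, w} (alg M.armPref) M δ T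

/-! ### The adaptive sampling algorithm -/

/-- A choice of a minimal matching cover for every set `E` of pairs: matchings inside `E` that contain
every pair of `E` exactly once, as few as any family of matchings covering `E` can have. The list is
the order in which they are sampled. -/
structure MatchingCover (P : Type u) (A : Type v) where
  cover : Finset (P × A) → List (P ≃. A)
  mem_of_mem : ∀ E, ∀ m ∈ cover E, ∀ p, ∀ a ∈ m p, (p, a) ∈ E
  exactly_once : ∀ E p a, (p, a) ∈ E → ∃! i : Fin (cover E).length, a ∈ ((cover E).get i) p
  minimal : ∀ E (L : List (P ≃. A)), (∀ p a, (p, a) ∈ E → ∃ m ∈ L, a ∈ m p) →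
    (cover E).length ≤ L.length

/-- A rule `argsort` listing the arms by decreasing value, with ties broken in any measurable way. -/
structure SortRule (A : Type v) [Fintype A] where
  argsort : (A → ℝ) → Ranking A
  antitone : ∀ f : A → ℝ, Antitone (fun i => f (argsort f i))
  measurable : ∀ r : Ranking A, MeasurableSet {f : A → ℝ | argsort f = r}

/-- The variables of the algorithm: the matchings still to be sampled in the current round, the
numbers of samples and the sums of the observed rewards of all pairs, and the current matching. -/
structure AdaptiveState (P : Type u) (A : Type v) : Type (max u v) where
  pending : List (P ≃. A)
  count : P → A → ℕ
  total : P → A → ℝ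
  estimate : P ≃. A

section Adaptive

variable {P : Type u} {A : Type v} [Fintype P] [DecidableEq P] [Fintype A] [DecidableEq A]

/-- Sample mean (`0` before the first sample). -/
noncomputable def sampleMean (n : P → A → ℕ) (s : P → A → ℝ) (p : P) (a : A) : ℝ :=
  s p a / n p a

/-- Confidence margin of a pair that has been sampled `k` times. -/
noncomputable def margin (P : Type u) (A : Type v) [Fintype P] [Fintype A] (δ : ℝ) (k : ℕ) : ℝ :=
  Real.sqrt (Real.log (4 * Fintype.card A * Fintype.card P * (k : ℝ) ^ 2 / δ) / (2 * k))

/-- Confidence interval of a pair. -/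
noncomputable def confInterval (δ : ℝ) (n : P → A → ℕ) (s : P → A → ℝ) (p : P) (a : A) : Set ℝ :=
  Set.Icc (sampleMean n s p a - margin P A δ (n p a)) (sampleMean n s p a + margin P A δ (n p a))

/-- Estimated preferences. -/
noncomputable def estPref (sort : SortRule A) (n : P → A → ℕ) (s : P → A → ℝ) (p : P) : Ranking A :=
  sort.argsort (sampleMean n s p)

/-- Deferred acceptance applied to the estimated preferences. -/
noncomputable def estMatching (sort : SortRule A) (ρ : A → Ranking P) (n : P → A → ℕ)
    (s : P → A → ℝ) : P ≃. A :=
  deferredAcceptance (estPref sort n s) ρ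

/-- The arms that are ranked by `p`, in the estimated preferences, at least as high as its partner
(all arms if `p` is unmatched). -/
def upToPartner (sort : SortRule A) (ρ : A → Ranking P) (n : P → A → ℕ) (s : P → A → ℝ) (p : P) :
    Set A :=
  {a | ∀ b ∈ estMatching sort ρ n s p, a = b ∨ (estPref sort n s p).Prefers a b}

open Classical in
/-- The pairs `(p, a)` with `a ∈ S_p`: the confidence interval of `a` meets that of another arm `a'`,
and at least one of the two arms is ranked up to the partner of `p`. -/
noncomputable def activePairs (δ : ℝ) (sort : SortRule A) (ρ : A → Ranking P) (n : P → A → ℕ)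
    (s : P → A → ℝ) : Finset (P × A) :=
  Finset.univ.filter fun x => ∃ a' : A, a' ≠ x.2 ∧
    (confInterval δ n s x.1 a' ∩ confInterval δ n s x.1 x.2).Nonempty ∧
    (({x.2, a'} : Set A) ∩ upToPartner sort ρ n s x.1).Nonempty

/-- The adaptive sampling algorithm. In the first round all pairs are sampled. At the end of a round
the current matching and the active pairs are recomputed, and the next round samples a minimal
matching cover of the active pairs. If there are none (then the cover is the empty list), the
algorithm terminates and returns the current matching. -/
noncomputable def adaptiveSampling (δ : ℝ) (cov : MatchingCover P A) (sort : SortRule A)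
    (ρ : A → Ranking P) : SamplingAlgorithm P A where
  State := AdaptiveState P A
  start :=
    { pending := cov.cover Finset.univ
      count := fun _ _ => 0
      total := fun _ _ => 0
      estimate := ⊥ }
  action σ :=
    match σ.pending with
    | m :: _ => .sample m
    | [] => .output σ.estimate
  observe σ y :=
    match σ.pending with
    | [] => σ
    | m :: rest =>
      let n : P → A → ℕ := fun p a => if m p = some a then σ.count p a + 1 else σ.count p a
      let s : P → A → ℝ := fun p a =>
        if m p = some a then σ.total p a + (y p).getD 0 else σ.total p a
      match rest with
      | _ :: _ => { pending := rest, count := n, total := s, estimate := σ.estimate }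
      | [] =>
        { pending := cov.cover (activePairs δ sort ρ n s)
          count := n
          total := s
          estimate := estMatching sort ρ n s }

end Adaptive

end StableBandit

namespace StableBandit

/-! The argument separates a deterministic statement about runs whose confidence intervals all
contain the means from a bound on the probability that this fails before a fixed time.

Deterministic part: if two overlapping intervals contain their means, at least one margin is not
below a quarter of the gap between the means, so one of the two pairs has fewer than `n₀` samples.
Both pairs are active, hence every further round raises the potential `∑ min (n p a) n₀`. Rounds
have at most `N K` samples, which bounds the running time by a constant (`exists_round`,
`exists_returns_isOptimalStable`). Once no pair is active, an arm truly preferred to an arm in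
`A[p]` is also ranked above it by the estimates. Deferred acceptance with the true preferences then
makes the same proposals as with the estimates (`deferredAcceptance_congr`), and its output is
optimal by Gale-Shapley.

Probabilistic part: which pair is sampled when depends on past rewards, so the samples of a pair are
not a fixed subsequence. An exponential supermartingale, frozen after the `k`-th sample of a pair,
handles this without a union over times (`lintegral_prod_ite_le_one`, `measure_exists_le_exp`). The
union bound over pairs, both tails and all `k` sums to at most `δ` because `∑ 1 / k ^ 2 ≤ 2`,
whatever the time horizon. -/

theorem Ranking.find?_eq_some_iff {α : Type u} [Fintype α] (r : Ranking α) (f : α → Bool) (a : α) :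
    ((List.finRange (Fintype.card α)).map r).find? f = some a ↔
      f a = true ∧ ∀ b, r.Prefers b a → f b = false := by
  rw [List.find?_map, Option.map_eq_some_iff]
  have key : ∀ i, (List.finRange (Fintype.card α)).find? (f ∘ r) = some i ↔
      f (r i) = true ∧ ∀ j < i, f (r j) = false := by
    intro i
    rw [List.find?_eq_some_iff_getElem]
    constructor
    · rintro ⟨h, k, hk, hki, hj⟩
      simp only [List.getElem_finRange] at hki hj
      subst hki
      refine ⟨h, fun j hj' => ?_⟩
      have := hj j (by simpa [Fin.lt_def] using hj')
      simpa using this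
    · rintro ⟨h, hj⟩
      refine ⟨h, i, by simp, by simp, fun j hj' => ?_⟩
      have := hj ⟨j, hj'.trans i.2⟩ (by simpa [Fin.lt_def] using hj')
      simpa using this
  constructor
  · rintro ⟨i, hi, rfl⟩
    obtain ⟨h1, h2⟩ := (key i).1 hi
    refine ⟨h1, fun b hb => ?_⟩
    have := h2 (r.symm b) (by simpa [Ranking.Prefers] using hb)
    simpa using this
  · rintro ⟨h1, h2⟩
    refine ⟨r.symm a, (key _).2 ⟨by simpa using h1, fun j hj => h2 _ ?_⟩, by simp⟩
    simpa [Ranking.Prefers] using hj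

theorem Ranking.find?_eq_none_iff {α : Type u} [Fintype α] (r : Ranking α) (f : α → Bool) :
    ((List.finRange (Fintype.card α)).map r).find? f = none ↔ ∀ b, f b = false := by
  rw [List.find?_eq_none]
  constructor
  · intro h b
    simpa using h b (List.mem_map.2 ⟨r.symm b, by simp, by simp⟩)
  · intro h b _
    simp [h b]

theorem Ranking.prefers_irrefl {α : Type u} [Fintype α] (r : Ranking α) (a : α) :
    ¬ r.Prefers a a := lt_irrefl _

theorem Ranking.Prefers.asymm {α : Type u} [Fintype α] {r : Ranking α} {a b : α}
    (h : r.Prefers a b) : ¬ r.Prefers b a := lt_asymm h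

theorem Ranking.Prefers.trans {α : Type u} [Fintype α] {r : Ranking α} {a b c : α}
    (h : r.Prefers a b) (h' : r.Prefers b c) : r.Prefers a c := lt_trans h h'

theorem Ranking.prefers_trichotomy {α : Type u} [Fintype α] (r : Ranking α) (a b : α) :
    r.Prefers a b ∨ a = b ∨ r.Prefers b a := by
  rcases lt_trichotomy (r.symm a) (r.symm b) with h | h | h
  · exact Or.inl h
  · exact Or.inr (Or.inl (r.symm.injective h))
  · exact Or.inr (Or.inr h)

/-! ### Gale-Shapley theory of deferred acceptance. -/

section Proposal

variable {P : Type u} {A : Type v} [Fintype A] [DecidableEq A]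

theorem proposal_eq_some_iff (π : P → Ranking A) (R : P → Finset A) (p : P) (a : A) :
    proposal π R p = some a ↔ a ∉ R p ∧ ∀ b, (π p).Prefers b a → b ∈ R p := by
  rw [proposal, Ranking.find?_eq_some_iff]
  simp

theorem proposal_eq_none_iff (π : P → Ranking A) (R : P → Finset A) (p : P) :
    proposal π R p = none ↔ ∀ a, a ∈ R p := by
  rw [proposal, Ranking.find?_eq_none_iff]
  simp

end Proposal

section DeferredAcceptanceTheory

variable {P : Type u} {A : Type v} [Fintype P] [Fintype A] [DecidableEq A]

theorem held_eq_some_iff (π : P → Ranking A) (ρ : A → Ranking P) (R : P → Finset A) (p : P) (a : A) :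
    held π ρ R a = some p ↔
      proposal π R p = some a ∧ ∀ q, (ρ a).Prefers q p → proposal π R q ≠ some a := by
  rw [held, Ranking.find?_eq_some_iff]
  simp

/-- An arm with a proposer holds one that it likes at least as much. -/
theorem exists_held (π : P → Ranking A) (ρ : A → Ranking P) (R : P → Finset A) {p : P} {a : A}
    (h : proposal π R p = some a) :
    ∃ q, held π ρ R a = some q ∧ (q = p ∨ (ρ a).Prefers q p) := by
  cases hq : held π ρ R a with
  | none =>
    simp only [held, Ranking.find?_eq_none_iff, decide_eq_false_iff_not] at hq
    exact absurd h (hq p)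
  | some q =>
    refine ⟨q, rfl, ?_⟩
    rw [held_eq_some_iff] at hq
    rcases (ρ a).prefers_trichotomy q p with h' | h' | h'
    · exact Or.inr h'
    · exact Or.inl h'
    · exact absurd h (hq.2 p h')

variable [DecidableEq P]

/-- The rejections after `t` stages of deferred acceptance. -/
def rejections (π : P → Ranking A) (ρ : A → Ranking P) (t : ℕ) : P → Finset A :=
  (daStage π ρ)^[t] (fun _ => ∅)

theorem rejections_succ (π : P → Ranking A) (ρ : A → Ranking P) (t : ℕ) :
    rejections π ρ (t + 1) = daStage π ρ (rejections π ρ t) :=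
  Function.iterate_succ_apply' _ _ _

theorem mem_daStage (π : P → Ranking A) (ρ : A → Ranking P) (R : P → Finset A) (p : P) (a : A) :
    a ∈ daStage π ρ R p ↔ a ∈ R p ∨ proposal π R p = some a ∧ held π ρ R a ≠ some p := by
  simp [daStage]

theorem rejections_mono (π : P → Ranking A) (ρ : A → Ranking P) (p : P) :
    Monotone fun t => rejections π ρ t p := by
  refine monotone_nat_of_le_succ fun t a ha => ?_
  rw [rejections_succ, mem_daStage]
  exact Or.inl ha

/-- An arm that has rejected a player holds a proposer that it prefers. -/
theorem exists_held_of_mem_rejections (π : P → Ranking A) (ρ : A → Ranking P) (t : ℕ) :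
    ∀ p, ∀ a ∈ rejections π ρ t p,
      ∃ q, held π ρ (rejections π ρ t) a = some q ∧ (ρ a).Prefers q p := by
  induction t with
  | zero => intro p a ha; simp [rejections] at ha
  | succ t ih =>
    intro p a ha
    rw [rejections_succ] at ha ⊢
    have h1 : ∃ q, held π ρ (rejections π ρ t) a = some q ∧ (ρ a).Prefers q p := by
      rcases (mem_daStage ..).1 ha with ha | ⟨ha, hne⟩
      · exact ih p a ha
      · obtain ⟨q, hq, hqp⟩ := exists_held π ρ _ ha
        refine ⟨q, hq, hqp.resolve_left ?_⟩
        rintro rfl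
        exact hne hq
    obtain ⟨q, hq, hqp⟩ := h1
    have hprop := proposal_of_held _ _ _ _ _ hq
    -- A held player is not rejected and the arms above `a` on its list remain closed to it, so it
    -- proposes to `a` again. Thus what `a` holds can only improve.
    have h2 : proposal π (daStage π ρ (rejections π ρ t)) q = some a := by
      rw [proposal_eq_some_iff] at hprop ⊢
      refine ⟨?_, fun b hb => (mem_daStage ..).2 (Or.inl (hprop.2 b hb))⟩
      rw [mem_daStage]
      rintro (h | h)
      · exact hprop.1 h
      · exact h.2 hq
    obtain ⟨q', hq', hle⟩ := exists_held π ρ _ h2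
    refine ⟨q', hq', ?_⟩
    rcases hle with rfl | hle
    · exact hqp
    · exact hle.trans hqp

/-- A player is never rejected by a partner in a stable matching. -/
theorem notMem_rejections_of_isStable {π : P → Ranking A} {ρ : A → Ranking P} {m : P ≃. A}
    (hm : IsStable π ρ m) (t : ℕ) : ∀ p, ∀ a ∈ m p, a ∉ rejections π ρ t p := by
  induction t with
  | zero => intro p a _; simp [rejections]
  | succ t ih =>
    intro p a ha hmem
    rw [rejections_succ, mem_daStage] at hmem
    obtain ⟨hprop, hne⟩ := hmem.resolve_left (ih p a ha)
    obtain ⟨q, hq, hqp⟩ := exists_held π ρ _ hprop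
    have hqne : q ≠ p := by rintro rfl; exact hne hq
    have hpref := hqp.resolve_left hqne
    have hnot : a ∉ m q := fun h => hqne (m.inj h ha)
    -- The player `q` who displaced `p` at `a` forms a blocking pair with `a`: by induction `q` has
    -- not been rejected by its partner in `m`, yet it has been rejected by everything above `a`.
    refine hm q a ⟨hnot, fun b hb => ?_, fun q' hq' => ?_⟩
    · have hqprop := (proposal_eq_some_iff ..).1 (proposal_of_held _ _ _ _ _ hq)
      rcases (π q).prefers_trichotomy a b with h | h | h
      · exact h
      · exact absurd (h ▸ hb) hnot
      · exact absurd (hqprop.2 b h) (ih q b hb)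
    · rw [PEquiv.mem_iff_mem] at hq'
      rw [m.inj hq' ha]
      exact hpref

/-- Every stage that changes something adds a rejection, and there are only `card P * card A`
possible ones, so the iteration has become stationary by then. -/
theorem daStage_finalRejections (π : P → Ranking A) (ρ : A → Ranking P) :
    daStage π ρ (finalRejections π ρ) = finalRejections π ρ := by
  have hsum : ∀ t, daStage π ρ (rejections π ρ t) ≠ rejections π ρ t →
      (∑ p, (rejections π ρ t p).card) < ∑ p, (rejections π ρ (t + 1) p).card := by
    intro t ht
    obtain ⟨p, hp⟩ := Function.ne_iff.1 ht
    refine Finset.sum_lt_sum (fun q _ => Finset.card_le_card (rejections_mono π ρ q t.le_succ))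
      ⟨p, Finset.mem_univ _, Finset.card_lt_card ?_⟩
    refine lt_of_le_of_ne (rejections_mono π ρ p t.le_succ) ?_
    rw [rejections_succ]
    exact fun h => hp h.symm
  by_contra hne
  have hall : ∀ t ≤ Fintype.card P * Fintype.card A,
      daStage π ρ (rejections π ρ t) ≠ rejections π ρ t := by
    intro t ht h
    apply hne
    have hconst : ∀ s, rejections π ρ (t + s) = rejections π ρ t := by
      intro s
      induction s with
      | zero => rfl
      | succ s ih => rw [← add_assoc, rejections_succ, ih, h]
    have hfin : finalRejections π ρ = rejections π ρ t := by
      obtain ⟨s, hs⟩ := Nat.exists_eq_add_of_le ht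
      rw [← hconst s, ← hs]
      rfl
    rw [hfin, h]
  have hge : ∀ t ≤ Fintype.card P * Fintype.card A + 1, t ≤ ∑ p, (rejections π ρ t p).card := by
    intro t
    induction t with
    | zero => simp
    | succ t ih =>
      intro ht
      have h1 := ih (by omega)
      have h2 := hsum t (hall t (by omega))
      omega
  have h1 := hge _ le_rfl
  have h2 : (∑ p, (rejections π ρ (Fintype.card P * Fintype.card A + 1) p).card)
      ≤ ∑ _p : P, Fintype.card A := Finset.sum_le_sum fun p _ => Finset.card_le_univ _
  simp only [Finset.sum_const, Finset.card_univ, smul_eq_mul] at h2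
  omega

/-- The partner under deferred acceptance is the last arm proposed to. -/
theorem deferredAcceptance_apply (π : P → Ranking A) (ρ : A → Ranking P) (p : P) :
    deferredAcceptance π ρ p = proposal π (finalRejections π ρ) p := by
  change (proposal π (finalRejections π ρ) p).filter _ = _
  cases ha : proposal π (finalRejections π ρ) p with
  | none => rfl
  | some a =>
  refine Option.filter_eq_some_iff.2 ⟨rfl, ?_⟩
  by_contra hne
  have hmem : a ∈ daStage π ρ (finalRejections π ρ) p :=
    (mem_daStage ..).2 (Or.inr ⟨ha, by simpa using hne⟩)
  rw [daStage_finalRejections] at hmem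
  exact ((proposal_eq_some_iff ..).1 ha).1 hmem

/-- An arm that `p` likes better than its outcome has rejected `p`, and therefore holds somebody it
prefers. -/
theorem isStable_deferredAcceptance (π : P → Ranking A) (ρ : A → Ranking P) :
    IsStable π ρ (deferredAcceptance π ρ) := by
  rintro p a ⟨hnot, hp, ha⟩
  have hmem : a ∈ finalRejections π ρ p := by
    rw [deferredAcceptance_apply] at hnot hp
    cases h : proposal π (finalRejections π ρ) p with
    | none => exact (proposal_eq_none_iff ..).1 h a
    | some b => exact ((proposal_eq_some_iff ..).1 h).2 a (hp b h)
  obtain ⟨q, hq, hqp⟩ := exists_held_of_mem_rejections π ρ _ p a hmem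
  exact hqp.asymm (ha q hq)

/-- The Gale-Shapley theorem: deferred acceptance returns the player-optimal stable matching. -/
theorem isOptimalStable_deferredAcceptance (π : P → Ranking A) (ρ : A → Ranking P) :
    IsOptimalStable π ρ (deferredAcceptance π ρ) := by
  refine ⟨isStable_deferredAcceptance π ρ, fun m' hm' p a' ha' => ?_⟩
  have hnot : a' ∉ finalRejections π ρ p := notMem_rejections_of_isStable hm' _ p a' ha'
  rw [deferredAcceptance_apply]
  cases h : proposal π (finalRejections π ρ) p with
  | none => exact absurd ((proposal_eq_none_iff ..).1 h a') hnot
  | some a =>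
    refine ⟨a, rfl, ?_⟩
    rcases (π p).prefers_trichotomy a a' with h' | h' | h'
    · exact Or.inr h'
    · exact Or.inl h'
    · exact absurd (((proposal_eq_some_iff ..).1 h).2 a' h') hnot

/-- Deferred acceptance only depends on the comparisons with the arms ranked at least as high as
the final partner. -/
theorem deferredAcceptance_congr (π π' : P → Ranking A) (ρ : A → Ranking P)
    (h : ∀ p a, (∀ b ∈ deferredAcceptance π ρ p, a = b ∨ (π p).Prefers a b) →
      ∀ b, (π' p).Prefers b a → (π p).Prefers b a) :
    deferredAcceptance π' ρ = deferredAcceptance π ρ := by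
  have hprop : ∀ t ≤ Fintype.card P * Fintype.card A,
      proposal π' (rejections π ρ t) = proposal π (rejections π ρ t) := by
    intro t ht
    funext p
    cases hp : proposal π (rejections π ρ t) p with
    | none => rwa [proposal_eq_none_iff] at hp ⊢
    | some a =>
      rw [proposal_eq_some_iff] at hp ⊢
      -- Rejections only grow, so the current proposal `a` ranks at or above the final partner and
      -- `h` applies to it: what `π'` places above `a`, `π` does too, and it has already rejected
      -- `p`.
      refine ⟨hp.1, fun b hb => hp.2 b (h p a (fun c hc => ?_) b hb)⟩
      rw [deferredAcceptance_apply] at hc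
      rcases (π p).prefers_trichotomy a c with h' | h' | h'
      · exact Or.inr h'
      · exact Or.inl h'
      · exact absurd (rejections_mono π ρ p ht (hp.2 c h')) ((proposal_eq_some_iff ..).1 hc).1
  have hheld : ∀ t ≤ Fintype.card P * Fintype.card A,
      held π' ρ (rejections π ρ t) = held π ρ (rejections π ρ t) := by
    intro t ht
    funext a
    simp only [held, hprop t ht]
  have hrej : ∀ t ≤ Fintype.card P * Fintype.card A, rejections π' ρ t = rejections π ρ t := by
    intro t
    induction t with
    | zero => intro _; rfl
    | succ t ih =>
      intro ht
      have ht' : t ≤ Fintype.card P * Fintype.card A := by omega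
      rw [rejections_succ, rejections_succ, ih ht']
      funext p
      simp only [daStage, hprop t ht', hheld t ht']
  have hfin : finalRejections π' ρ = finalRejections π ρ := hrej _ le_rfl
  refine PEquiv.ext fun p => ?_
  rw [deferredAcceptance_apply, deferredAcceptance_apply, hfin]
  exact congrFun (hprop _ le_rfl) p

end DeferredAcceptanceTheory

/-! ### Minimal matching covers. -/

section Cover

variable {P : Type u} {A : Type v}

/-- Minimality against the empty family excludes a useless matching, so an empty queue at the start
of a round means exactly that no pair is active. -/
theorem MatchingCover.cover_eq_nil_iff (cov : MatchingCover P A) (E : Finset (P × A)) :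
    cov.cover E = [] ↔ E = ∅ := by
  constructor
  · intro h
    refine Finset.eq_empty_of_forall_notMem fun x hx => ?_
    obtain ⟨i, -⟩ := (cov.exactly_once E x.1 x.2 hx).exists
    have := i.2
    simp [h] at this
  · rintro rfl
    have := cov.minimal ∅ [] (by simp)
    exact List.eq_nil_of_length_eq_zero (by simpa using this)

theorem MatchingCover.exists_mem (cov : MatchingCover P A) {E : Finset (P × A)} {p : P} {a : A}
    (h : (p, a) ∈ E) : ∃ m ∈ cov.cover E, m p = some a := by
  obtain ⟨i, hi, -⟩ := cov.exactly_once E p a h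
  exact ⟨_, List.get_mem _ i, hi⟩

/-- Compare with the family of all one-pair matchings. This bounds the length of a round. -/
theorem MatchingCover.length_cover_le [Fintype P] [DecidableEq P] [Fintype A] [DecidableEq A]
    (cov : MatchingCover P A) (E : Finset (P × A)) :
    (cov.cover E).length ≤ Fintype.card P * Fintype.card A := by
  have h := cov.minimal E
    ((Finset.univ : Finset (P × A)).toList.map fun x => PEquiv.single x.1 x.2) (by
      intro p a _
      refine ⟨PEquiv.single p a, List.mem_map.2 ⟨(p, a), by simp, rfl⟩, by simp⟩)
  simpa using h

end Cover

/-! ### The run of the algorithm, step by step and round by round. -/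

section Run

variable {P : Type u} {A : Type v} [Fintype P] [DecidableEq P] [Fintype A] [DecidableEq A]

/-- The counts after sampling the matching `m`. -/
def nextCount (m : P ≃. A) (n : P → A → ℕ) : P → A → ℕ :=
  fun p a => if m p = some a then n p a + 1 else n p a

/-- The sums of the rewards after sampling the matching `m` with rewards `x`. -/
noncomputable def nextTotal (m : P ≃. A) (s x : P → A → ℝ) : P → A → ℝ :=
  fun p a => if m p = some a then s p a + x p a else s p a

variable (δ : ℝ) (cov : MatchingCover P A) (sort : SortRule A) (ρ : A → Ranking P)

/-- The state in which a new round starts. -/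
noncomputable def roundStart (n : P → A → ℕ) (s : P → A → ℝ) : AdaptiveState P A where
  pending := cov.cover (activePairs δ sort ρ n s)
  count := n
  total := s
  estimate := estMatching sort ρ n s

/-- One time step of the adaptive sampling algorithm. -/
noncomputable def adaptiveStep (x : P → A → ℝ) (σ : AdaptiveState P A) : AdaptiveState P A :=
  match σ.pending with
  | [] => σ
  | [m] => roundStart δ cov sort ρ (nextCount m σ.count) (nextTotal m σ.total x)
  | m :: m' :: rest =>
    { pending := m' :: rest
      count := nextCount m σ.count
      total := nextTotal m σ.total x
      estimate := σ.estimate }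

/-- The state of the adaptive sampling algorithm after `t` time steps. -/
noncomputable def adaptiveRun (x : ℕ → P → A → ℝ) : ℕ → AdaptiveState P A
  | 0 =>
    { pending := cov.cover Finset.univ
      count := fun _ _ => 0
      total := fun _ _ => 0
      estimate := ⊥ }
  | t + 1 => adaptiveStep δ cov sort ρ (x t) (adaptiveRun x t)

theorem step_adaptiveSampling (x : P → A → ℝ) (σ : AdaptiveState P A) :
    (adaptiveSampling δ cov sort ρ).step x σ = adaptiveStep δ cov sort ρ x σ := by
  -- The default `0` never enters: a reward is added only where `m p = some a`.
  have htot : ∀ m : P ≃. A, (fun p a => if m p = some a then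
      σ.total p a + ((m p).map (x p)).getD 0 else σ.total p a) = nextTotal m σ.total x := by
    intro m
    funext p a
    by_cases h : m p = some a <;> simp [nextTotal, h]
  obtain ⟨pending, count, total, estimate⟩ := σ
  match pending with
  | [] => rfl
  | [m] =>
    have := htot m
    simp only at this
    simp only [SamplingAlgorithm.step, adaptiveSampling, this, adaptiveStep]
    rfl
  | m :: m' :: rest =>
    have := htot m
    simp only at this
    simp only [SamplingAlgorithm.step, adaptiveSampling, this, adaptiveStep]
    rfl

theorem run_adaptiveSampling (x : ℕ → P → A → ℝ) (t : ℕ) :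
    (adaptiveSampling δ cov sort ρ).run x t = adaptiveRun δ cov sort ρ x t := by
  induction t with
  | zero => rfl
  | succ t ih =>
    rw [SamplingAlgorithm.run, ih, adaptiveRun]
    exact step_adaptiveSampling δ cov sort ρ _ _

theorem returns_adaptiveSampling {x : ℕ → P → A → ℝ} {T : ℕ}
    (h : (adaptiveRun δ cov sort ρ x T).pending = []) :
    (adaptiveSampling δ cov sort ρ).Returns x T (adaptiveRun δ cov sort ρ x T).estimate := by
  rw [SamplingAlgorithm.Returns, run_adaptiveSampling]
  simp only [adaptiveSampling, h]

theorem adaptiveRun_eq_of_le {x : ℕ → P → A → ℝ} {t T : ℕ} (ht : t ≤ T)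
    (h : (adaptiveRun δ cov sort ρ x t).pending = []) :
    adaptiveRun δ cov sort ρ x T = adaptiveRun δ cov sort ρ x t := by
  induction T, ht using Nat.le_induction with
  | base => rfl
  | succ T _ ih =>
    rw [adaptiveRun, ih]
    simp only [adaptiveStep, h]

/-- A whole round: all pending matchings are sampled. -/
theorem exists_adaptiveRun_eq_roundStart (x : ℕ → P → A → ℝ) (l : List (P ≃. A)) (hl : l ≠ [])
    (t : ℕ) (h : (adaptiveRun δ cov sort ρ x t).pending = l) :
    ∃ s, adaptiveRun δ cov sort ρ x (t + l.length) = roundStart δ cov sort ρ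
      (fun p a => (adaptiveRun δ cov sort ρ x t).count p a + l.countP fun m => m p = some a) s := by
  induction l generalizing t with
  | nil => exact absurd rfl hl
  | cons m l ih =>
    match l with
    | [] =>
      refine ⟨nextTotal m (adaptiveRun δ cov sort ρ x t).total (x t), ?_⟩
      simp only [List.length_singleton, adaptiveRun, adaptiveStep, h]
      congr 1
      funext p a
      by_cases hm : m p = some a <;> simp [nextCount, hm]
    | m' :: rest =>
      have hstep : adaptiveRun δ cov sort ρ x (t + 1) =
          { pending := m' :: rest
            count := nextCount m (adaptiveRun δ cov sort ρ x t).count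
            total := nextTotal m (adaptiveRun δ cov sort ρ x t).total (x t)
            estimate := (adaptiveRun δ cov sort ρ x t).estimate } := by
        simp only [adaptiveRun, adaptiveStep, h]
      obtain ⟨s, hs⟩ := ih (by simp) (t + 1) (by rw [hstep])
      refine ⟨s, ?_⟩
      rw [List.length_cons, add_comm (m' :: rest).length 1, ← add_assoc, hs, hstep]
      congr 1
      funext p a
      rw [List.countP_cons (a := m)]
      by_cases hm : m p = some a
      · simp [nextCount, hm]
        omega
      · simp [nextCount, hm]

/-- In this form the condition is visibly symmetric in `a` and `a'`, so the arm that makes `a`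
active is active as well. -/
theorem mem_activePairs {n : P → A → ℕ} {s : P → A → ℝ} {p : P} {a : A} :
    (p, a) ∈ activePairs δ sort ρ n s ↔ ∃ a' : A, a' ≠ a ∧
      (confInterval δ n s p a' ∩ confInterval δ n s p a).Nonempty ∧
      (a ∈ upToPartner sort ρ n s p ∨ a' ∈ upToPartner sort ρ n s p) := by
  simp only [activePairs, Finset.mem_filter, Finset.mem_univ, true_and]
  refine exists_congr fun a' => and_congr_right fun _ => and_congr_right fun _ => ?_
  constructor
  · rintro ⟨b, rfl | rfl, hb⟩
    · exact Or.inl hb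
    · exact Or.inr hb
  · rintro (hb | hb)
    · exact ⟨a, Or.inl rfl, hb⟩
    · exact ⟨a', Or.inr rfl, hb⟩

end Run

/-! ### Margins, and correctness when the intervals contain the means. -/

open Filter Topology in
theorem tendsto_margin (P : Type u) (A : Type v) [Fintype P] [Fintype A] (δ : ℝ) :
    Tendsto (fun k : ℕ => margin P A δ k) atTop (𝓝 0) := by
  have hlog : Tendsto (fun k : ℕ => Real.log k / k) atTop (𝓝 0) :=
    (Real.isLittleO_log_id_atTop.tendsto_div_nhds_zero).comp tendsto_natCast_atTop_atTop
  have hinv : Tendsto (fun k : ℕ => ((k : ℝ))⁻¹) atTop (𝓝 0) := tendsto_inv_atTop_nhds_zero_nat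
  have key : ∀ c : ℝ, Tendsto (fun k : ℕ => Real.log (c * (k : ℝ) ^ 2 / δ) / (2 * k)) atTop (𝓝 0) := by
    intro c
    -- In the degenerate case the logarithm is `Real.log 0 = 0`. Otherwise it splits into a constant
    -- and `2 * log k`, whatever the sign of `c / δ`.
    by_cases hc : c / δ = 0
    · refine tendsto_const_nhds.congr fun k => ?_
      rw [mul_div_right_comm, hc]
      simp
    · have h := (hinv.const_mul (Real.log (c / δ) / 2)).add hlog
      simp only [mul_zero, add_zero] at h
      refine h.congr' ?_
      filter_upwards [eventually_gt_atTop 0] with k hk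
      have hk' : (k : ℝ) ≠ 0 := by positivity
      rw [mul_div_right_comm, Real.log_mul hc (by positivity), Real.log_pow]
      field_simp
      push_cast
      ring
  have h := (Real.continuous_sqrt.tendsto 0).comp (key (4 * Fintype.card A * Fintype.card P))
  rw [Real.sqrt_zero] at h
  exact h

section Confidence

variable {P : Type u} {A : Type v} [Fintype P] [Fintype A]

/-- The mean reward of a pair. -/
noncomputable def Market.mean (M : Market P A) (p : P) (a : A) : ℝ := ∫ x, x ∂(M.rewardLaw p a)

theorem Market.prefers_iff (M : Market P A) (p : P) (a b : A) :
    (M.playerPref p).Prefers a b ↔ M.mean p b < M.mean p a := by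
  have h := (M.strictAnti_mean p).lt_iff_gt (a := (M.playerPref p).symm b)
    (b := (M.playerPref p).symm a)
  simp only [Equiv.apply_symm_apply] at h
  exact h.symm

theorem Market.mean_injective (M : Market P A) (p : P) : Function.Injective (M.mean p) := by
  intro a b hab
  rcases (M.playerPref p).prefers_trichotomy a b with h | h | h
  · exact absurd hab ((M.prefers_iff p a b).1 h).ne'
  · exact h
  · exact absurd hab ((M.prefers_iff p b a).1 h).ne

/-- After sufficiently many samples the margins are small compared with the gaps between means. -/
theorem Market.exists_margin_lt (M : Market P A) (δ : ℝ) :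
    ∃ n₀ : ℕ, ∀ k ≥ n₀, ∀ p a b, a ≠ b → margin P A δ k < |M.mean p a - M.mean p b| / 4 := by
  rw [← Filter.eventually_atTop]
  simp only [Filter.eventually_all]
  intro p a b hab
  refine (tendsto_margin P A δ).eventually_lt_const ?_
  have : M.mean p a - M.mean p b ≠ 0 := sub_ne_zero.2 fun h => hab (M.mean_injective p h)
  positivity

/-- The confidence intervals of all sampled pairs contain the means. -/
def Market.IsCovered (M : Market P A) (δ : ℝ) (n : P → A → ℕ) (s : P → A → ℝ) : Prop :=
  ∀ p a, 0 < n p a → |sampleMean n s p a - M.mean p a| ≤ margin P A δ (n p a)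

variable [DecidableEq P] [DecidableEq A] {M : Market P A} {δ : ℝ} {sort : SortRule A}
  {ρ : A → Ranking P} {n : P → A → ℕ} {s : P → A → ℝ}

/-- Intervals that contain their means and are short compared with the gap cannot meet. This
supplies the undersampled pair that makes each round progress. -/
theorem Market.IsCovered.exists_lt_of_mem_activePairs (h : M.IsCovered δ n s)
    (hn : ∀ p a, 0 < n p a) {n₀ : ℕ}
    (hn₀ : ∀ k ≥ n₀, ∀ p a b, a ≠ b → margin P A δ k < |M.mean p a - M.mean p b| / 4)
    {p : P} {a : A} (ha : (p, a) ∈ activePairs δ sort ρ n s) :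
    ∃ b, (p, b) ∈ activePairs δ sort ρ n s ∧ n p b < n₀ := by
  obtain ⟨b, hba, hne, hup⟩ := (mem_activePairs δ sort ρ).1 ha
  by_cases hna : n p a < n₀
  · exact ⟨a, ha, hna⟩
  by_cases hnb : n p b < n₀
  · exact ⟨b, (mem_activePairs δ sort ρ).2 ⟨a, hba.symm, by rwa [Set.inter_comm], hup.symm⟩, hnb⟩
  exfalso
  obtain ⟨y, ⟨hb1, hb2⟩, ha1, ha2⟩ := hne
  have h1 := abs_le.1 (h p a (hn p a))
  have h2 := abs_le.1 (h p b (hn p b))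
  have h3 := hn₀ _ (not_lt.1 hna) p b a hba
  have h4 := hn₀ _ (not_lt.1 hnb) p b a hba
  -- Each mean is within twice its margin of the common point `y`. This is why `n₀` asks for a
  -- quarter of the gap.
  have h5 : |M.mean p b - M.mean p a| ≤ 2 * margin P A δ (n p a) + 2 * margin P A δ (n p b) :=
    abs_le.2 ⟨by linarith, by linarith⟩
  linarith

/-- Without active pairs, the estimated and the true preferences agree on the relevant arms. -/
theorem Market.IsCovered.prefers_of_activePairs_eq_empty (h : M.IsCovered δ n s)
    (hn : ∀ p a, 0 < n p a) (hE : activePairs δ sort ρ n s = ∅) {p : P} {a b : A}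
    (ha : a ∈ upToPartner sort ρ n s p) (hb : (M.playerPref p).Prefers b a) :
    (estPref sort n s p).Prefers b a := by
  have hne : b ≠ a := by rintro rfl; exact Ranking.prefers_irrefl _ _ hb
  have hmean := (M.prefers_iff p b a).1 hb
  rcases (estPref sort n s p).prefers_trichotomy b a with h' | h' | h'
  · exact h'
  · exact absurd h' hne
  exfalso
  have hle : sampleMean n s p b ≤ sampleMean n s p a := by
    have := sort.antitone (sampleMean n s p) (le_of_lt h')
    simpa [estPref] using this
  have h1 := abs_le.1 (h p a (hn p a))
  have h2 := abs_le.1 (h p b (hn p b))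
  -- The estimates are ordered against the means, which forces intervals containing the means to
  -- overlap.
  have hmem : (p, a) ∈ activePairs δ sort ρ n s := by
    refine (mem_activePairs δ sort ρ).2 ⟨b, hne, ?_, Or.inl ha⟩
    rw [confInterval, confInterval, Set.Icc_inter_Icc, Set.nonempty_Icc]
    exact sup_le (le_inf (by linarith) (by linarith)) (le_inf (by linarith) (by linarith))
  simp [hE] at hmem

/-- The estimated run serves as the reference in `deferredAcceptance_congr`, and the true
preferences imitate it. -/
theorem Market.IsCovered.isOptimalStable_estMatching
    (h : M.IsCovered δ n s) (hn : ∀ p a, 0 < n p a)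
    (hE : activePairs δ sort M.armPref n s = ∅) :
    IsOptimalStable M.playerPref M.armPref (estMatching sort M.armPref n s) := by
  have := deferredAcceptance_congr (estPref sort n s) M.playerPref M.armPref
    fun p a ha b hb => h.prefers_of_activePairs_eq_empty hn hE ha hb
  rw [estMatching, ← this]
  exact isOptimalStable_deferredAcceptance _ _

end Confidence

/-! ### Termination within a deterministic time. -/

section Termination

variable {P : Type u} {A : Type v} [Fintype P] [DecidableEq P] [Fintype A] [DecidableEq A]

/-- If the confidence intervals contain the means up to time `T`, then after `r + 1` rounds either
there are no active pairs, or at least `r` samples of insufficiently sampled pairs were taken. -/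
theorem exists_round {M : Market P A} {δ : ℝ} (cov : MatchingCover P A) (sort : SortRule A)
    {n₀ : ℕ} (hn₀ : ∀ k ≥ n₀, ∀ p a b, a ≠ b → margin P A δ k < |M.mean p a - M.mean p b| / 4)
    {x : ℕ → P → A → ℝ} {T : ℕ} [Nonempty P] [Nonempty A]
    (hx : ∀ t ≤ T, M.IsCovered δ (adaptiveRun δ cov sort M.armPref x t).count
      (adaptiveRun δ cov sort M.armPref x t).total) (r : ℕ)
    (hr : Fintype.card P * Fintype.card A * (r + 1) ≤ T) :
    ∃ t ≤ Fintype.card P * Fintype.card A * (r + 1), ∃ n s,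
      adaptiveRun δ cov sort M.armPref x t = roundStart δ cov sort M.armPref n s ∧
      (∀ p a, 0 < n p a) ∧
      (activePairs δ sort M.armPref n s = ∅ ∨ r ≤ ∑ p, ∑ a, min (n p a) n₀) := by
  induction r with
  | zero =>
    obtain ⟨s, hs⟩ := exists_adaptiveRun_eq_roundStart δ cov sort M.armPref x
      (cov.cover Finset.univ) (by
        rw [Ne, cov.cover_eq_nil_iff]
        exact Finset.univ_nonempty.ne_empty) 0 rfl
    refine ⟨_, by simpa using cov.length_cover_le _, _, s, hs, fun p a => ?_, Or.inr (Nat.zero_le _)⟩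
    obtain ⟨m, hm, hpa⟩ := cov.exists_mem (Finset.mem_univ (p, a))
    refine Nat.add_pos_right _ (List.countP_pos_iff.2 ⟨m, hm, by simpa using hpa⟩)
  | succ r ih =>
    obtain ⟨t, ht, n, s, hrun, hpos, hsum⟩ := ih (le_trans (by gcongr; omega) hr)
    by_cases hE : activePairs δ sort M.armPref n s = ∅
    · exact ⟨t, ht.trans (by gcongr; omega), n, s, hrun, hpos, Or.inl hE⟩
    obtain ⟨s', hs'⟩ := exists_adaptiveRun_eq_roundStart δ cov sort M.armPref x
      (cov.cover (activePairs δ sort M.armPref n s)) (by rwa [Ne, cov.cover_eq_nil_iff]) t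
      (by rw [hrun]; rfl)
    refine ⟨_, ?_, _, s', hs', fun p a => ?_, Or.inr ?_⟩
    · have := cov.length_cover_le (activePairs δ sort M.armPref n s)
      calc _ ≤ Fintype.card P * Fintype.card A * (r + 1) + Fintype.card P * Fintype.card A := by
            omega
        _ = _ := by ring
    · rw [hrun]
      exact Nat.add_pos_left (hpos p a) _
    · have hcov := hx t (ht.trans (le_trans (by gcongr; omega) hr))
      rw [hrun] at hcov
      obtain ⟨⟨p, a⟩, hpa⟩ := Finset.nonempty_iff_ne_empty.2 hE
      obtain ⟨b, hb, hlt⟩ := hcov.exists_lt_of_mem_activePairs hpos hn₀ hpa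
      replace hlt : n p b < n₀ := hlt
      obtain ⟨m, hm, hpb⟩ := cov.exists_mem hb
      have hcount : 0 < (cov.cover (activePairs δ sort M.armPref n s)).countP
          fun m => m p = some b := List.countP_pos_iff.2 ⟨m, hm, by simpa using hpb⟩
      -- The undersampled active pair `(p, b)` lies in the cover, so its truncated count rises and
      -- no other one falls.
      refine Nat.succ_le_of_lt (lt_of_le_of_lt (hsum.resolve_left hE) ?_)
      rw [hrun]
      refine Finset.sum_lt_sum (fun q _ => Finset.sum_le_sum fun c _ => ?_) ⟨p, Finset.mem_univ _,
        Finset.sum_lt_sum (fun c _ => ?_) ⟨b, Finset.mem_univ _, ?_⟩⟩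
      · exact min_le_min_right _ (Nat.le_add_right _ _)
      · exact min_le_min_right _ (Nat.le_add_right _ _)
      · simp only [roundStart]
        omega

/-- There is a time at which the algorithm has returned the player-optimal stable matching, if the
confidence intervals contain the means until then. -/
theorem exists_returns_isOptimalStable (M : Market P A) (δ : ℝ) (cov : MatchingCover P A)
    (sort : SortRule A) : ∃ T, ∀ x : ℕ → P → A → ℝ,
      (∀ t ≤ T, M.IsCovered δ (adaptiveRun δ cov sort M.armPref x t).count
        (adaptiveRun δ cov sort M.armPref x t).total) →
      ∃ m, (adaptiveSampling δ cov sort M.armPref).Returns x T m ∧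
        IsOptimalStable M.playerPref M.armPref m := by
  by_cases hne : Nonempty P ∧ Nonempty A
  · obtain ⟨_, _⟩ := hne
    obtain ⟨n₀, hn₀⟩ := M.exists_margin_lt δ
    -- The potential never exceeds `card P * card A * n₀`, so `r` one larger excludes the second
    -- alternative of `exists_round`. The last `+ 1` is the initial round.
    refine ⟨Fintype.card P * Fintype.card A * (Fintype.card P * Fintype.card A * n₀ + 1 + 1),
      fun x hx => ?_⟩
    obtain ⟨t, ht, n, s, hrun, hpos, hsum⟩ := exists_round cov sort hn₀ hx _ le_rfl
    have hE : activePairs δ sort M.armPref n s = ∅ := by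
      refine hsum.resolve_right fun hle => ?_
      have : ∑ p, ∑ a, min (n p a) n₀ ≤ ∑ _p : P, ∑ _a : A, n₀ :=
        Finset.sum_le_sum fun p _ => Finset.sum_le_sum fun a _ => min_le_right _ _
      simp only [Finset.sum_const, Finset.card_univ, smul_eq_mul, ← mul_assoc] at this
      omega
    have hpend : (adaptiveRun δ cov sort M.armPref x t).pending = [] := by
      rw [hrun]
      exact (cov.cover_eq_nil_iff _).2 hE
    have heq := adaptiveRun_eq_of_le δ cov sort M.armPref ht hpend
    refine ⟨_, returns_adaptiveSampling δ cov sort M.armPref (by rw [heq, hpend]), ?_⟩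
    have hcov := hx t ht
    rw [heq]
    rw [hrun] at hcov ⊢
    exact hcov.isOptimalStable_estMatching hpos hE
  -- Without players or without arms the first cover is empty: the algorithm stops at once, and
  -- stability is vacuous.
  · refine ⟨0, fun x _ => ⟨_, returns_adaptiveSampling δ cov sort M.armPref ?_, ?_, ?_⟩⟩
    · refine (cov.cover_eq_nil_iff _).2 (Finset.eq_empty_of_forall_notMem fun y _ => ?_)
      exact hne ⟨⟨y.1⟩, ⟨y.2⟩⟩
    · exact fun p a => absurd ⟨⟨p⟩, ⟨a⟩⟩ hne
    · exact fun m _ p a => absurd ⟨⟨p⟩, ⟨a⟩⟩ hne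

end Termination

/-! ### Measurable dependence of the state on past rewards. -/

section Measurability

variable {P : Type u} {A : Type v} {Ω : Type w} {mΩ : MeasurableSpace Ω}

theorem measurable_sampleMean (n : P → A → ℕ) (p : P) :
    Measurable fun s : P → A → ℝ => sampleMean n s p := by
  unfold sampleMean
  fun_prop

theorem measurable_nextTotal [DecidableEq A] (m : P ≃. A) {s x : Ω → P → A → ℝ} (hs : Measurable s)
    (hx : Measurable x) : Measurable fun ω => nextTotal m (s ω) (x ω) := by
  refine measurable_pi_lambda _ fun p => measurable_pi_lambda _ fun a => ?_
  by_cases hm : m p = some a <;> simp only [nextTotal, hm, if_true, if_false] <;> fun_prop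

/-- The part of the state that influences the future is measurable. -/
structure IsMeasurableState {Ω : Type w} (mΩ : MeasurableSpace Ω) (σ : Ω → AdaptiveState P A) :
    Prop where
  measurableSet : ∀ l n, MeasurableSet[mΩ] {ω | (σ ω).pending = l ∧ (σ ω).count = n}
  measurable_total : Measurable[mΩ] fun ω => (σ ω).total

variable [Fintype P] [Fintype A] {σ : Ω → AdaptiveState P A}

/-- Makes lists of matchings countable, as the countable unions over queues below require. -/
instance : Finite (P ≃. A) :=
  Finite.of_injective (fun m : P ≃. A => (m : P → Option A)) DFunLike.coe_injective

/-- There are finitely many preference profiles, and `SortRule.measurable` handles each. -/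
theorem measurableSet_estPref (sort : SortRule A) (n : P → A → ℕ) (Q : (P → Ranking A) → Prop) :
    MeasurableSet {s | Q (estPref sort n s)} := by
  have h : ∀ r : P → Ranking A, MeasurableSet {s | estPref sort n s = r} := by
    intro r
    have : {s | estPref sort n s = r} =
        ⋂ p, (fun s : P → A → ℝ => sampleMean n s p) ⁻¹' {f | sort.argsort f = r p} := by
      ext s
      simp [funext_iff, estPref]
    rw [this]
    exact MeasurableSet.iInter fun p => measurable_sampleMean n p (sort.measurable _)
  have : {s | Q (estPref sort n s)} = ⋃ r ∈ {r | Q r}, {s | estPref sort n s = r} := by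
    ext s
    simp
  rw [this]
  exact MeasurableSet.biUnion (Set.to_countable _) fun r _ => h r

theorem measurableSet_confInterval_inter (δ : ℝ) (n : P → A → ℕ) (p : P) (a b : A) :
    MeasurableSet {s | (confInterval δ n s p a ∩ confInterval δ n s p b).Nonempty} := by
  have h : ∀ c, Measurable fun s : P → A → ℝ => sampleMean n s p c := fun c =>
    (measurable_pi_apply c).comp (measurable_sampleMean n p)
  simp only [confInterval, Set.Icc_inter_Icc, Set.nonempty_Icc]
  exact measurableSet_le (((h a).sub_const _).sup ((h b).sub_const _))
    (((h a).add_const _).inf ((h b).add_const _))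

/-- Queue and counts take countably many values, so it suffices to treat them as frozen. -/
theorem IsMeasurableState.measurableSet_of_forall (h : IsMeasurableState mΩ σ)
    (R : List (P ≃. A) → (P → A → ℕ) → Ω → Prop) (hR : ∀ l n, MeasurableSet {ω | R l n ω}) :
    MeasurableSet {ω | R (σ ω).pending (σ ω).count ω} := by
  have : {ω | R (σ ω).pending (σ ω).count ω} =
      ⋃ l, ⋃ n, {ω | (σ ω).pending = l ∧ (σ ω).count = n} ∩ {ω | R l n ω} := by
    ext ω
    simp
  rw [this]
  exact MeasurableSet.iUnion fun l => MeasurableSet.iUnion fun n => (h.measurableSet l n).inter (hR l n)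

variable [DecidableEq P] [DecidableEq A]

theorem measurableSet_activePairs (δ : ℝ) (sort : SortRule A) (ρ : A → Ranking P) (n : P → A → ℕ)
    (Q : Finset (P × A) → Prop) : MeasurableSet {s | Q (activePairs δ sort ρ n s)} := by
  have hup : ∀ p a, MeasurableSet {s | a ∈ upToPartner sort ρ n s p} := fun p a =>
    measurableSet_estPref sort n fun r =>
      ∀ b ∈ deferredAcceptance r ρ p, a = b ∨ (r p).Prefers a b
  have hmem : ∀ y, MeasurableSet {s | y ∈ activePairs δ sort ρ n s} := by
    rintro ⟨p, a⟩
    simp only [mem_activePairs]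
    have : {s : P → A → ℝ | ∃ a' : A, a' ≠ a ∧
        (confInterval δ n s p a' ∩ confInterval δ n s p a).Nonempty ∧
        (a ∈ upToPartner sort ρ n s p ∨ a' ∈ upToPartner sort ρ n s p)} =
        ⋃ a' : A, {_s | a' ≠ a} ∩
        ({s | (confInterval δ n s p a' ∩ confInterval δ n s p a).Nonempty} ∩
        ({s | a ∈ upToPartner sort ρ n s p} ∪ {s | a' ∈ upToPartner sort ρ n s p})) := by
      ext s
      simp
    rw [this]
    exact MeasurableSet.iUnion fun a' => (MeasurableSet.const _).inter
      ((measurableSet_confInterval_inter δ n p a' a).inter ((hup p a).union (hup p a')))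
  have h : ∀ E, MeasurableSet {s | activePairs δ sort ρ n s = E} := by
    intro E
    have : {s | activePairs δ sort ρ n s = E} =
        ⋂ y, {s | y ∈ activePairs δ sort ρ n s ↔ y ∈ E} := by
      ext s
      rw [Set.mem_iInter]
      exact Finset.ext_iff
    rw [this]
    exact MeasurableSet.iInter fun y => (hmem y).iff (MeasurableSet.const _)
  have : {s | Q (activePairs δ sort ρ n s)} =
      ⋃ E ∈ {E | Q E}, {s | activePairs δ sort ρ n s = E} := by
    ext s
    simp
  rw [this]
  exact MeasurableSet.biUnion (Set.to_countable _) fun E _ => h E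

/-- The matching `m` sampled next contains the pair `(p, a)`. -/
def AdaptiveState.Samples (σ : AdaptiveState P A) (p : P) (a : A) : Prop :=
  ∃ m ∈ σ.pending.head?, m p = some a

-- The same recursion holds whether or not the step ends a round. `prod_ite_exp_eq` needs it in this
-- form.
open Classical in
theorem count_adaptiveStep (δ : ℝ) (cov : MatchingCover P A) (sort : SortRule A) (ρ : A → Ranking P)
    (x : P → A → ℝ) (σ : AdaptiveState P A) (p : P) (a : A) :
    (adaptiveStep δ cov sort ρ x σ).count p a =
      if σ.Samples p a then σ.count p a + 1 else σ.count p a := by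
  obtain ⟨pending, count, total, estimate⟩ := σ
  match pending with
  | [] => simp [adaptiveStep, AdaptiveState.Samples]
  | [m] => simp [adaptiveStep, AdaptiveState.Samples, roundStart, nextCount]
  | m :: m' :: rest => simp [adaptiveStep, AdaptiveState.Samples, nextCount]

open Classical in
theorem total_adaptiveStep (δ : ℝ) (cov : MatchingCover P A) (sort : SortRule A) (ρ : A → Ranking P)
    (x : P → A → ℝ) (σ : AdaptiveState P A) (p : P) (a : A) :
    (adaptiveStep δ cov sort ρ x σ).total p a =
      if σ.Samples p a then σ.total p a + x p a else σ.total p a := by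
  obtain ⟨pending, count, total, estimate⟩ := σ
  match pending with
  | [] => simp [adaptiveStep, AdaptiveState.Samples]
  | [m] => simp [adaptiveStep, AdaptiveState.Samples, roundStart, nextTotal]
  | m :: m' :: rest => simp [adaptiveStep, AdaptiveState.Samples, nextTotal]

theorem IsMeasurableState.adaptiveStep (h : IsMeasurableState mΩ σ) (δ : ℝ)
    (cov : MatchingCover P A) (sort : SortRule A) (ρ : A → Ranking P) {x : Ω → P → A → ℝ}
    (hx : Measurable x) :
    IsMeasurableState mΩ fun ω => StableBandit.adaptiveStep δ cov sort ρ (x ω) (σ ω) := by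
  classical
  constructor
  · intro l' n'
    -- `S` describes the next queue and counts for a frozen current queue and counts. Only the end
    -- of a round, a queue of length one, looks at the rewards.
    let S : List (P ≃. A) → (P → A → ℕ) → Ω → Prop := fun l n ω => match l with
      | [] => [] = l' ∧ n = n'
      | [m] => cov.cover (activePairs δ sort ρ (nextCount m n)
          (nextTotal m (σ ω).total (x ω))) = l' ∧ nextCount m n = n'
      | m :: m' :: rest => m' :: rest = l' ∧ nextCount m n = n'
    have hS : ∀ ω, ((StableBandit.adaptiveStep δ cov sort ρ (x ω) (σ ω)).pending = l' ∧
        (StableBandit.adaptiveStep δ cov sort ρ (x ω) (σ ω)).count = n') ↔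
        S (σ ω).pending (σ ω).count ω := by
      intro ω
      dsimp only [S]
      generalize (σ ω) = τ
      obtain ⟨pending, count, total, estimate⟩ := τ
      match pending with
      | [] => rfl
      | [m] => rfl
      | m :: m' :: rest => rfl
    simp only [hS]
    refine h.measurableSet_of_forall S fun l n => ?_
    match l with
    | [] => exact MeasurableSet.const _
    | [m] =>
      exact (measurable_nextTotal m h.measurable_total hx
        (measurableSet_activePairs δ sort ρ (nextCount m n) fun E => cov.cover E = l')).inter
        (MeasurableSet.const _)
    | m :: m' :: rest => exact MeasurableSet.const _
  · refine measurable_pi_lambda _ fun p => measurable_pi_lambda _ fun a => ?_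
    have ht := h.measurable_total
    simp only [total_adaptiveStep]
    refine Measurable.ite ?_ (by fun_prop) (by fun_prop)
    exact h.measurableSet_of_forall (fun l _ _ => ∃ m ∈ l.head?, m p = some a)
      fun l n => MeasurableSet.const _

/-- The σ-algebra is arbitrary. For the one generated by the first `t` rewards, this says that the
choice made at time `t` is predictable. -/
theorem isMeasurableState_adaptiveRun (δ : ℝ) (cov : MatchingCover P A) (sort : SortRule A)
    (ρ : A → Ranking P) (X : ℕ → Ω → P → A → ℝ) (t : ℕ) (hX : ∀ i < t, Measurable (X i)) :
    IsMeasurableState mΩ fun ω => adaptiveRun δ cov sort ρ (fun i => X i ω) t := by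
  induction t with
  | zero =>
    exact ⟨fun l n => MeasurableSet.const (cov.cover Finset.univ = l ∧ (fun _ _ => 0) = n),
      measurable_const⟩
  | succ t ih =>
    exact (ih fun i hi => hX i (by omega)).adaptiveStep δ cov sort ρ (hX t (by omega))

end Measurability

/-! ### Concentration under adaptive sampling. -/

section Concentration

/-- If the factors that enter are chosen by looking only at the past of an independent sequence,
the expectation of the product of factors of expectation at most one is at most one. -/
theorem lintegral_prod_ite_le_one {Ω S : Type*} {mΩ : MeasurableSpace Ω} [mS : MeasurableSpace S]
    {μ : Measure Ω} [IsProbabilityMeasure μ] {X : ℕ → Ω → S} (hX : ∀ t, Measurable (X t))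
    (hind : iIndepFun X μ) {g : S → ENNReal} (hg : Measurable g)
    (hg1 : ∀ t, ∫⁻ ω, g (X t ω) ∂μ ≤ 1) (D : ℕ → Ω → Prop) [∀ t ω, Decidable (D t ω)]
    (hD : ∀ t, MeasurableSet[⨆ i ∈ Set.Iio t, mS.comap (X i)] {ω | D t ω}) (T : ℕ) :
    (Measurable[⨆ i ∈ Set.Iio T, mS.comap (X i)] fun ω =>
      ∏ i ∈ Finset.range T, if D i ω then g (X i ω) else 1) ∧
    ∫⁻ ω, ∏ i ∈ Finset.range T, (if D i ω then g (X i ω) else 1) ∂μ ≤ 1 := by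
  have hle : ∀ t, mS.comap (X t) ≤ mΩ := fun t => (hX t).comap_le
  have hFle : ∀ t, (⨆ i ∈ Set.Iio t, mS.comap (X i)) ≤ mΩ := fun t => iSup₂_le fun i _ => hle i
  have hmono : ∀ {t t'}, t ≤ t' → (⨆ i ∈ Set.Iio t, mS.comap (X i)) ≤
      ⨆ i ∈ Set.Iio t', mS.comap (X i) := fun h =>
    biSup_mono fun i (hi : i < _) => lt_of_lt_of_le hi h
  have hXF : ∀ t, mS.comap (X t) ≤ ⨆ i ∈ Set.Iio (t + 1), mS.comap (X i) := fun t =>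
    le_biSup (fun i => mS.comap (X i)) (Set.mem_Iio.2 t.lt_succ_self)
  have hgX : ∀ t, Measurable[mS.comap (X t)] fun ω => g (X t ω) := fun t =>
    hg.comp (comap_measurable (X t))
  induction T with
  | zero => exact ⟨by simp, by simp⟩
  | succ T ih =>
    obtain ⟨ihm, ihl⟩ := ih
    set W := fun ω => ∏ i ∈ Finset.range T, if D i ω then g (X i ω) else 1 with hW
    have hprod : (fun ω => ∏ i ∈ Finset.range (T + 1), if D i ω then g (X i ω) else 1) =
        fun ω => W ω * if D T ω then g (X T ω) else 1 := by
      funext ω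
      rw [Finset.prod_range_succ]
    simp only [funext_iff] at hprod
    simp only [hprod]
    have hWD : Measurable[⨆ i ∈ Set.Iio T, mS.comap (X i)] fun ω => if D T ω then W ω else 0 :=
      Measurable.ite (hD T) ihm measurable_const
    have hWD' : Measurable[⨆ i ∈ Set.Iio T, mS.comap (X i)] fun ω => if D T ω then 0 else W ω :=
      Measurable.ite (hD T) measurable_const ihm
    constructor
    · refine (ihm.mono (hmono T.le_succ) le_rfl).mul ?_
      exact Measurable.ite (hmono T.le_succ _ (hD T)) ((hgX T).mono (hXF T) le_rfl) measurable_const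
    · have hindep : Indep (⨆ i ∈ Set.Iio T, mS.comap (X i)) (mS.comap (X T)) μ := by
        have := indep_iSup_of_disjoint hle hind.iIndep
          (S := Set.Iio T) (T := {T}) (by simp)
        simpa only [Set.mem_singleton_iff, iSup_iSup_eq_left] using this
      -- Where `D T` fails the product is unchanged; where it holds, the new factor is independent
      -- of the past and integrates to at most one.
      have hsplit : ∀ ω, (W ω * if D T ω then g (X T ω) else 1) =
          (if D T ω then W ω else 0) * g (X T ω) + if D T ω then 0 else W ω := by
        intro ω
        split_ifs <;> simp
      calc ∫⁻ ω, W ω * (if D T ω then g (X T ω) else 1) ∂μ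
          = ∫⁻ ω, (if D T ω then W ω else 0) * g (X T ω) ∂μ + ∫⁻ ω, (if D T ω then 0 else W ω) ∂μ := by
            simp only [hsplit]
            exact lintegral_add_right _ (hWD'.mono (hFle T) le_rfl)
        _ = (∫⁻ ω, (if D T ω then W ω else 0) ∂μ) * ∫⁻ ω, g (X T ω) ∂μ +
              ∫⁻ ω, (if D T ω then 0 else W ω) ∂μ := by
            rw [lintegral_mul_eq_lintegral_mul_lintegral_of_independent_measurableSpace
              (hFle T) (hle T) hindep hWD (hgX T)]
        _ ≤ (∫⁻ ω, (if D T ω then W ω else 0) ∂μ) + ∫⁻ ω, (if D T ω then 0 else W ω) ∂μ := by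
            gcongr
            exact mul_le_of_le_one_right' (hg1 T)
        _ = ∫⁻ ω, W ω ∂μ := by
            rw [← lintegral_add_right _ (hWD'.mono (hFle T) le_rfl)]
            refine lintegral_congr fun ω => ?_
            split_ifs <;> simp
        _ ≤ 1 := ihl

/-- Hoeffding's lemma for the exponential factors. -/
theorem lintegral_exp_le_one {ν : Measure ℝ} [IsProbabilityMeasure ν]
    (hν : ∀ᵐ x ∂ν, x ∈ Set.Icc (0 : ℝ) 1) (l : ℝ) :
    ∫⁻ y, ENNReal.ofReal (Real.exp (l * (y - ∫ x, x ∂ν) - l ^ 2 / 8)) ∂ν ≤ 1 := by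
  have h := hasSubgaussianMGF_of_mem_Icc (X := fun x : ℝ => x) aemeasurable_id hν
  have hint := h.integrable_exp_mul l
  have hmgf := h.mgf_le l
  -- A variable in an interval of length one has variance proxy `1 / 4`.
  have hc : (((‖(1 : ℝ) - 0‖₊ / 2) ^ 2 : NNReal) : ℝ) * l ^ 2 / 2 = l ^ 2 / 8 := by
    simp
    ring
  rw [hc, mgf] at hmgf
  have heq : ∀ y, Real.exp (l * (y - ∫ x, x ∂ν) - l ^ 2 / 8) =
      Real.exp (l * (y - ∫ x, x ∂ν)) * Real.exp (-(l ^ 2 / 8)) := fun y => by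
    rw [← Real.exp_add, sub_eq_add_neg]
  simp only [heq]
  rw [← ofReal_integral_eq_lintegral_ofReal (hint.mul_const _)
    (Filter.Eventually.of_forall fun y => by positivity), integral_mul_const]
  refine ENNReal.ofReal_le_one.2 ?_
  calc _ ≤ Real.exp (l ^ 2 / 8) * Real.exp (-(l ^ 2 / 8)) := by gcongr
    _ = 1 := by rw [← Real.exp_add]; simp

/-- The product of the exponential factors of the first `k` sampled values. -/
theorem prod_ite_exp_eq {d : ℕ → Prop} [DecidablePred d] {n : ℕ → ℕ} {s y : ℕ → ℝ}
    (hn0 : n 0 = 0) (hs0 : s 0 = 0) (hn : ∀ t, n (t + 1) = if d t then n t + 1 else n t)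
    (hs : ∀ t, s (t + 1) = if d t then s t + y t else s t) (l c : ℝ) {t T k : ℕ} (htT : t ≤ T)
    (hk : n t = k) :
    ∏ i ∈ Finset.range T, (if d i ∧ n i < k then
      ENNReal.ofReal (Real.exp (l * (y i - c) - l ^ 2 / 8)) else 1) =
    ENNReal.ofReal (Real.exp (l * (s t - k * c) - l ^ 2 / 8 * k)) := by
  have hmono : Monotone n := monotone_nat_of_le_succ fun t => by
    rw [hn]
    split_ifs <;> omega
  induction T, htT using Nat.le_induction with
  | succ T hT ih =>
    -- Once `k` samples are taken the guard `n i < k` fails, so the product is frozen.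
    rw [Finset.prod_range_succ, ih, if_neg, mul_one]
    have := hmono hT
    omega
  | base =>
    have key : ∀ t, n t ≤ k → ∏ i ∈ Finset.range t, (if d i ∧ n i < k then
        ENNReal.ofReal (Real.exp (l * (y i - c) - l ^ 2 / 8)) else 1) =
        ENNReal.ofReal (Real.exp (l * (s t - n t * c) - l ^ 2 / 8 * n t)) := by
      intro t
      induction t with
      | zero => simp [hn0, hs0]
      | succ t ih =>
        intro hle
        rw [Finset.prod_range_succ, ih ((hmono t.le_succ).trans hle), hn, hs]
        by_cases hd : d t
        · have hlt : n t < k := by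
            rw [hn, if_pos hd] at hle
            omega
          rw [if_pos ⟨hd, hlt⟩, if_pos hd, if_pos hd, ← ENNReal.ofReal_mul (Real.exp_nonneg _),
            ← Real.exp_add]
          congr 2
          push_cast
          ring
        · rw [if_neg fun h => hd h.1, if_neg hd, if_neg hd, mul_one]
    rw [key t hk.le, hk]

/-- The margin is chosen to give this Hoeffding tail. The bound `δ ≤ 1` makes the logarithm
nonnegative, so that squaring undoes the root. -/
theorem exp_neg_two_mul_margin_sq {P : Type u} {A : Type v} [Fintype P] [Fintype A] {δ : ℝ} (hδ : 0 < δ) (hδ1 : δ ≤ 1) [Nonempty P] [Nonempty A]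
    {k : ℕ} (hk : 0 < k) : Real.exp (-(2 * k * margin P A δ k ^ 2)) =
      δ / (4 * Fintype.card A * Fintype.card P) * ((k : ℝ) ^ 2)⁻¹ := by
  have hP : (1 : ℝ) ≤ Fintype.card P := by exact_mod_cast Fintype.card_pos
  have hA : (1 : ℝ) ≤ Fintype.card A := by exact_mod_cast Fintype.card_pos
  have hk1 : (1 : ℝ) ≤ k := by exact_mod_cast hk
  have h1 : 1 ≤ 4 * Fintype.card A * Fintype.card P * (k : ℝ) ^ 2 / δ := by
    rw [one_le_div hδ]
    have : (1 : ℝ) ≤ 4 * Fintype.card A * Fintype.card P * (k : ℝ) ^ 2 := by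
      have h2 : (1 : ℝ) ≤ (k : ℝ) ^ 2 := one_le_pow₀ hk1
      have h3 : (1 : ℝ) ≤ 4 * Fintype.card A := by linarith
      exact one_le_mul_of_one_le_of_one_le (one_le_mul_of_one_le_of_one_le h3 hP) h2
    linarith
  rw [margin, Real.sq_sqrt (div_nonneg (Real.log_nonneg h1) (by positivity)),
    mul_div_cancel₀ _ (by positivity), Real.exp_neg, Real.exp_log (by linarith)]
  field_simp

variable {P : Type u} {A : Type v} [Fintype P] [DecidableEq P] [Fintype A] [DecidableEq A]

/-- The product frozen after `k` samples has the same value at every time when the count is `k`.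
Markov's inequality for this single variable therefore covers all `t ≤ T`. -/
theorem measure_exists_le_exp {M : Market P A} {Ω : Type w} [MeasurableSpace Ω] {μ : Measure Ω}
    [IsProbabilityMeasure μ] {X : ℕ → Ω → P → A → ℝ} (hX : IsRewardSequence M μ X) (δ : ℝ)
    (cov : MatchingCover P A) (sort : SortRule A) (ρ : A → Ranking P) (p : P) (a : A) (k T : ℕ)
    (l c : ℝ) :
    μ {ω | ∃ t ≤ T, (adaptiveRun δ cov sort ρ (fun i => X i ω) t).count p a = k ∧
      c ≤ l * ((adaptiveRun δ cov sort ρ (fun i => X i ω) t).total p a - k * M.mean p a) -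
        l ^ 2 / 8 * k} ≤ ENNReal.ofReal (Real.exp (-c)) := by
  classical
  have := M.isProbabilityMeasure p a
  let σ : Ω → ℕ → AdaptiveState P A := fun ω => adaptiveRun δ cov sort ρ (fun i => X i ω)
  let h : ℝ → ENNReal := fun y => ENNReal.ofReal (Real.exp (l * (y - M.mean p a) - l ^ 2 / 8))
  have hh : Measurable h := by fun_prop
  have heval : Measurable fun x : P → A → ℝ => x p a := by fun_prop
  have hint : ∀ t, ∫⁻ ω, h (X t ω p a) ∂μ ≤ 1 := by
    intro t
    have hm : Measurable fun ω => X t ω p a := heval.comp (hX.measurable t)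
    rw [← lintegral_map hh hm, hX.law]
    exact lintegral_exp_le_one (M.mem_unitInterval p a) l
  have hD : ∀ t, MeasurableSet[⨆ i ∈ Set.Iio t, MeasurableSpace.comap (X i) inferInstance]
      {ω | (σ ω t).Samples p a ∧ (σ ω t).count p a < k} := by
    intro t
    have hst := isMeasurableState_adaptiveRun
      (mΩ := ⨆ i ∈ Set.Iio t, MeasurableSpace.comap (X i) inferInstance) δ cov sort ρ X t
      fun i hi => measurable_iff_comap_le.2
        (le_biSup (fun i => MeasurableSpace.comap (X i) inferInstance) (Set.mem_Iio.2 hi))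
    exact hst.measurableSet_of_forall (fun q n _ => (∃ m ∈ q.head?, m p = some a) ∧ n p a < k)
      fun q n => MeasurableSet.const _
  obtain ⟨hm, hle⟩ := lintegral_prod_ite_le_one hX.measurable hX.indep (hh.comp heval) hint
    (fun t ω => (σ ω t).Samples p a ∧ (σ ω t).count p a < k) hD T
  have hm' := hm.mono (iSup₂_le fun i _ => (hX.measurable i).comap_le) le_rfl
  calc _ ≤ μ {ω | ENNReal.ofReal (Real.exp c) ≤ ∏ i ∈ Finset.range T,
        if (σ ω i).Samples p a ∧ (σ ω i).count p a < k then (h ∘ fun x => x p a) (X i ω) else 1} := by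
        refine measure_mono ?_
        rintro ω ⟨t, ht, hk, hc⟩
        have := prod_ite_exp_eq (d := fun t => (σ ω t).Samples p a)
          (n := fun t => (σ ω t).count p a) (s := fun t => (σ ω t).total p a)
          (y := fun t => X t ω p a) rfl rfl (fun t => count_adaptiveStep ..)
          (fun t => total_adaptiveStep ..) l (M.mean p a) ht hk
        refine le_of_le_of_eq ?_ this.symm
        exact ENNReal.ofReal_le_ofReal (Real.exp_le_exp.2 hc)
    _ ≤ _ / ENNReal.ofReal (Real.exp c) := meas_ge_le_lintegral_div hm'.aemeasurable
        (by simp [Real.exp_pos]) ENNReal.ofReal_ne_top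
    _ ≤ 1 / ENNReal.ofReal (Real.exp c) := by gcongr
    _ = _ := by
        rw [one_div, ← ENNReal.ofReal_inv_of_pos (Real.exp_pos _), Real.exp_neg]

theorem count_adaptiveRun_le (δ : ℝ) (cov : MatchingCover P A) (sort : SortRule A)
    (ρ : A → Ranking P) (x : ℕ → P → A → ℝ) (p : P) (a : A) (t : ℕ) :
    (adaptiveRun δ cov sort ρ x t).count p a ≤ t := by
  classical
  induction t with
  | zero => exact le_rfl
  | succ t ih =>
    rw [adaptiveRun, count_adaptiveStep]
    split_ifs <;> omega

/-- With probability at least `1 - δ`, all confidence intervals up to time `T` contain the means. -/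
theorem measure_not_isCovered_le {M : Market P A} {Ω : Type w} [MeasurableSpace Ω] {μ : Measure Ω}
    [IsProbabilityMeasure μ] {X : ℕ → Ω → P → A → ℝ} (hX : IsRewardSequence M μ X) {δ : ℝ}
    (hδ : 0 < δ) (hδ1 : δ ≤ 1) (cov : MatchingCover P A) (sort : SortRule A) (ρ : A → Ranking P)
    (T : ℕ) :
    μ {ω | ¬ ∀ t ≤ T, M.IsCovered δ (adaptiveRun δ cov sort ρ (fun i => X i ω) t).count
      (adaptiveRun δ cov sort ρ (fun i => X i ω) t).total} ≤ ENNReal.ofReal δ := by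
  by_cases hne : Nonempty P ∧ Nonempty A
  swap
  · refine le_of_eq_of_le ?_ zero_le
    convert measure_empty (μ := μ)
    refine Set.eq_empty_of_forall_notMem fun ω hω => hω fun t _ p a => ?_
    exact absurd ⟨⟨p⟩, ⟨a⟩⟩ hne
  obtain ⟨_, _⟩ := hne
  -- With deviation at least `k α`, the exponent `l k α - l ^ 2 k / 8` is maximal at `l = 4 α`, with
  -- value `2 k α ^ 2`; `l = -4 α` treats the lower tail.
  let B : P → A → ℕ → ℝ → Set Ω := fun p a k l =>
    {ω | ∃ t ≤ T, (adaptiveRun δ cov sort ρ (fun i => X i ω) t).count p a = k ∧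
      2 * k * margin P A δ k ^ 2 ≤
        l * ((adaptiveRun δ cov sort ρ (fun i => X i ω) t).total p a - k * M.mean p a) -
        l ^ 2 / 8 * k}
  have hsub : {ω | ¬ ∀ t ≤ T, M.IsCovered δ (adaptiveRun δ cov sort ρ (fun i => X i ω) t).count
      (adaptiveRun δ cov sort ρ (fun i => X i ω) t).total} ⊆
      ⋃ p ∈ (Finset.univ : Finset P), ⋃ a ∈ (Finset.univ : Finset A), ⋃ k ∈ Finset.Ioc 0 T,
        B p a k (4 * margin P A δ k) ∪ B p a k (-(4 * margin P A δ k)) := by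
    intro ω hω
    simp only [Set.mem_ofPred_eq, Market.IsCovered, not_forall, not_le] at hω
    obtain ⟨t, ht, p, a, hpos, hlt⟩ := hω
    simp only [Set.mem_iUnion]
    refine ⟨p, Finset.mem_univ _, a, Finset.mem_univ _, _, Finset.mem_Ioc.2 ⟨hpos,
      (count_adaptiveRun_le δ cov sort ρ _ p a t).trans ht⟩, ?_⟩
    have hk : (0 : ℝ) < (adaptiveRun δ cov sort ρ (fun i => X i ω) t).count p a := by
      exact_mod_cast hpos
    have hα := Real.sqrt_nonneg
      (Real.log (4 * Fintype.card A * Fintype.card P *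
        ((adaptiveRun δ cov sort ρ (fun i => X i ω) t).count p a : ℝ) ^ 2 / δ) /
        (2 * (adaptiveRun δ cov sort ρ (fun i => X i ω) t).count p a))
    rw [← margin] at hα
    have hmean : sampleMean (adaptiveRun δ cov sort ρ (fun i => X i ω) t).count
        (adaptiveRun δ cov sort ρ (fun i => X i ω) t).total p a *
        (adaptiveRun δ cov sort ρ (fun i => X i ω) t).count p a =
        (adaptiveRun δ cov sort ρ (fun i => X i ω) t).total p a := div_mul_cancel₀ _ hk.ne'
    rcases lt_abs.1 hlt with h | h
    · refine Or.inl ⟨t, ht, rfl, ?_⟩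
      rw [← hmean]
      have := mul_le_mul_of_nonneg_left h.le (mul_nonneg hα hk.le)
      linarith
    · refine Or.inr ⟨t, ht, rfl, ?_⟩
      rw [← hmean]
      have := mul_le_mul_of_nonneg_left h.le (mul_nonneg hα hk.le)
      linarith
  have hB : ∀ p a, ∀ k ∈ Finset.Ioc 0 T, ∀ l, μ (B p a k l) ≤
      ENNReal.ofReal (δ / (4 * Fintype.card A * Fintype.card P) * ((k : ℝ) ^ 2)⁻¹) := by
    intro p a k hk l
    rw [← exp_neg_two_mul_margin_sq hδ hδ1 (Finset.mem_Ioc.1 hk).1]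
    exact measure_exists_le_exp hX δ cov sort ρ p a k T l _
  have hsum : ∑ k ∈ Finset.Ioc 0 T, ((k : ℝ) ^ 2)⁻¹ ≤ 2 := by
    have := sum_Ioo_inv_sq_le (α := ℝ) 0 (T + 1)
    have heq : Finset.Ioo 0 (T + 1) = Finset.Ioc 0 T := by ext; simp
    rw [heq] at this
    simpa using this
  calc _ ≤ ∑ _p : P, ∑ _a : A, ∑ k ∈ Finset.Ioc 0 T,
        ENNReal.ofReal (2 * (δ / (4 * Fintype.card A * Fintype.card P) * ((k : ℝ) ^ 2)⁻¹)) := by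
        refine (measure_mono hsub).trans <| (measure_biUnion_finset_le _ _).trans <|
          Finset.sum_le_sum fun p _ => (measure_biUnion_finset_le _ _).trans <|
          Finset.sum_le_sum fun a _ => (measure_biUnion_finset_le _ _).trans <|
          Finset.sum_le_sum fun k hk => (measure_union_le _ _).trans ?_
        rw [two_mul, ENNReal.ofReal_add (by positivity) (by positivity)]
        exact add_le_add (hB p a k hk _) (hB p a k hk _)
    _ = ENNReal.ofReal (δ / 2 * ∑ k ∈ Finset.Ioc 0 T, ((k : ℝ) ^ 2)⁻¹) := by
        rw [← ENNReal.ofReal_sum_of_nonneg fun k _ => by positivity]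
        simp only [Finset.sum_const, Finset.card_univ, ← mul_assoc, nsmul_eq_mul]
        rw [← ENNReal.ofReal_natCast, ← ENNReal.ofReal_natCast,
          ← ENNReal.ofReal_mul (by positivity), ← ENNReal.ofReal_mul (by positivity),
          ← Finset.mul_sum]
        congr 1
        have hP : (Fintype.card P : ℝ) ≠ 0 := by exact_mod_cast Fintype.card_ne_zero
        have hA : (Fintype.card A : ℝ) ≠ 0 := by exact_mod_cast Fintype.card_ne_zero
        field_simp
        ring
    _ ≤ ENNReal.ofReal δ := by
        refine ENNReal.ofReal_le_ofReal ?_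
        have := mul_le_mul_of_nonneg_left hsum (half_pos hδ).le
        linarith

end Concentration

end StableBandit

/-! ### Conclusion: combining the two parts. -/

theorem theorem4 {P : Type u} {A : Type v} [Fintype P] [DecidableEq P] [Fintype A] [DecidableEq A]
    (hcard : Fintype.card P ≤ Fintype.card A) (δ : ℝ) (hδ : 0 < δ)
    (cov : StableBandit.MatchingCover P A) (sort : StableBandit.SortRule A) :
    StableBandit.IsPCOS.{u, v, w} (StableBandit.adaptiveSampling δ cov sort) δ := by
  intro M
  obtain ⟨T, hT⟩ := StableBandit.exists_returns_isOptimalStable M δ cov sort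
  refine ⟨T, fun Ω _ μ _ X hX => ?_⟩
  -- For `δ > 1` the required probability is nonpositive, and nothing has to be shown.
  rcases le_or_gt δ 1 with hδ1 | hδ1
  · have hbad := StableBandit.measure_not_isCovered_le hX hδ hδ1 cov sort M.armPref T
    rw [ENNReal.ofReal_sub _ hδ.le, ENNReal.ofReal_one, tsub_le_iff_right, ← measure_univ (μ := μ)]
    refine le_trans ?_ (add_le_add_right hbad _)
    refine (measure_mono fun ω _ => ?_).trans (measure_union_le _ _)
    by_cases hω : ∀ t ≤ T, M.IsCovered δ
        (StableBandit.adaptiveRun δ cov sort M.armPref (fun i => X i ω) t).count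
        (StableBandit.adaptiveRun δ cov sort M.armPref (fun i => X i ω) t).total
    · exact Or.inl (hT _ hω)
    · exact Or.inr hω
  · rw [ENNReal.ofReal_of_nonpos (by linarith)]
    exact zero_le
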